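/- For a finite discrete alphabet $\Sigma$, let $\mathrm{Aut}(\Sigma^{\mathbb N})$ be the group, under composition, of all homeomorphisms of $\Sigma^{\mathbb N}$ (with the product topology) that commute with the shift $\sigma(x)_i = x_{i+1}$. For $n \in \mathbb N$, let $\mathcal G'_n$ be the class of all groups that are isomorphic to a subgroup of $\mathrm{Aut}(\Sigma^{\mathbb N})$, where $|\Sigma| = n$. For a finite simple graph $\Gamma = (V,E)$ and groups $(G_i)_{i \in V}$, the graph product $(G_i)_{i\in V}^{\Gamma}$ is the quotient of the free product of the groups $G_i$ by the normal subgroup generated by all commutators $[a,b] = aba^{-1}b^{-1}$ with $a \in G_i$, $b \in G_j$ and $\{i,j\} \in E$. **Theorem.** Let $\Gamma = (V,E)$ be a finite simple graph and let $G_i \in \mathcal G'_{n_i}$ for every $i \in V$, where $n_i \in \mathbb N$. Then the graph product satisfies $$(G_i)_{i\in V}^{\Gamma} \in \mathcal G'_{\max_{i \in V} n_i + 1},$$ where the maximum is taken to be $0$ if $V$ is empty. -/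

import Mathlib

/-- The automorphism group `Aut(A^ℕ)` of the one-sided full shift over the alphabet `A`: all
homeomorphisms of `ℕ → A` (product topology) commuting with the shift `σ(x)_i = x_{i+1}`,
under composition. -/
def OneSidedAut (A : Type*) [TopologicalSpace A] : Subgroup ((ℕ → A) ≃ₜ (ℕ → A)) where
  carrier := {f | ∀ x : ℕ → A, f (SymbolicDynamics.FullShift.shift (1 : ℕ) x) =
    SymbolicDynamics.FullShift.shift (1 : ℕ) (f x)}
  one_mem' := fun _ => rfl
  mul_mem' := by
    intro f g hf hg x
    rw [Homeomorph.mul_apply, Homeomorph.mul_apply, hg, hf]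
  inv_mem' := by
    intro f hf x
    apply f.injective
    rw [hf]
    change f (f.symm _) = SymbolicDynamics.FullShift.shift (1 : ℕ) (f (f.symm x))
    rw [Homeomorph.apply_symm_apply, Homeomorph.apply_symm_apply]

/-- The class `𝒢'_n`: groups isomorphic to a subgroup of `Aut(A^ℕ)` where `A` is a discrete
alphabet with `n` symbols. -/
def InOneSidedClass (n : ℕ) (G : Type*) [Group G] : Prop :=
  ∃ H : Subgroup (OneSidedAut (Fin n)), Nonempty (G ≃* H)

/-- The relators of the graph product inside the free product of the node groups: all
commutators `[a, b] = a b a⁻¹ b⁻¹` with `a ∈ G i`, `b ∈ G j` and `{i, j}` an edge. -/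
def graphProductRelators {V : Type*} (Γ : SimpleGraph V) (G : V → Type*) [∀ i, Group (G i)] :
    Set (Monoid.CoprodI G) :=
  {r | ∃ i j : V, Γ.Adj i j ∧ ∃ (a : G i) (b : G j),
    r = (Monoid.CoprodI.of a * Monoid.CoprodI.of b * (Monoid.CoprodI.of a)⁻¹ *
      (Monoid.CoprodI.of b)⁻¹ : Monoid.CoprodI G)}

/-- The graph product of the groups `G i` over the graph `Γ`: the free product of the node groups
modulo the relations that `G i` and `G j` commute whenever `{i, j}` is an edge. -/
def GraphProduct {V : Type*} (Γ : SimpleGraph V) (G : V → Type*) [∀ i, Group (G i)] : Type _ :=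
  Monoid.CoprodI G ⧸ Subgroup.normalClosure (graphProductRelators Γ G)

instance GraphProduct.instGroup {V : Type*} (Γ : SimpleGraph V) (G : V → Type*)
    [∀ i, Group (G i)] : Group (GraphProduct Γ G) :=
  inferInstanceAs
    (Group (Monoid.CoprodI G ⧸ Subgroup.normalClosure (graphProductRelators Γ G)))

/-! Let `N` be the largest `n i`. Embed every vertex group in `OneSidedAut (Fin N)` and use the
extra symbol as a marker. A block of type `v` consists of two ordinary symbols, a marker, and `m`
positions in which the only marker is at `e v`. A run of consecutive blocks of type `v` carries two
strands, its first and its second symbols. An automorphism acts on a finite strand by repeating the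
last symbol forever: since it commutes with the shift it preserves sequences constant from a given
position on, so the result can be written back and the action is a homomorphism (`Strands.hom`).

The two strands differ in one respect: the final first cell of a run is frozen, hence not part of
any strand, unless the run is followed by a lock, a block with two equal symbols whose type is not
adjacent to `v`. Acting at a vertex adjacent to `v` cannot alter such a lock, so adjacent vertices
act by commuting maps (`blockHom_commute`), and the graph product acts.

Faithfulness: a nontrivial element has a nonempty reduced word. By induction on its length there is
a configuration whose first block keeps its two symbols equal under all proper suffixes but not
under the whole word (`IsReducedWord.exists_unbalanced`). If the leading letter's vertex `v` occurs
again, a letter at a nonadjacent vertex `u` lies before the next occurrence. The induction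
hypothesis for the suffix starting with that letter gives a lock that is closed while the later
letters at `v` act and open when the leading one acts. A segment of type `v` put in front has equal
strands up to then; after that the first strand is one cell shorter, and the length of the segment
is chosen so that the leading letter detects this. -/

/-- The configuration `x` seen from position `k` on. -/
def tail {A : Type*} (k : ℕ) (x : ℕ → A) : ℕ → A := fun i => x (k + i)

/-! ### Tails and shift-commuting maps -/

section Tail

variable {A : Type*}

@[simp]
theorem tail_apply (k : ℕ) (x : ℕ → A) (i : ℕ) : tail k x i = x (k + i) := rfl

@[simp]
theorem tail_zero (x : ℕ → A) : tail 0 x = x := by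
  funext i
  simp

@[simp]
theorem tail_tail (j k : ℕ) (x : ℕ → A) : tail j (tail k x) = tail (k + j) x := by
  funext i
  simp [add_assoc]

theorem tail_comm (j k : ℕ) (x : ℕ → A) : tail j (tail k x) = tail k (tail j x) := by
  rw [tail_tail, tail_tail, add_comm]

theorem continuous_tail [TopologicalSpace A] (k : ℕ) :
    Continuous (tail k : (ℕ → A) → (ℕ → A)) :=
  continuous_pi fun i => continuous_apply (k + i)

theorem OneSidedAut.map_tail [TopologicalSpace A] (f : OneSidedAut A) (k : ℕ) (x : ℕ → A) :
    f.1 (tail k x) = tail k (f.1 x) := by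
  induction k generalizing x with
  | zero => simp
  | succ k ih =>
    have h : ∀ y : ℕ → A, f.1 (tail 1 y) = tail 1 (f.1 y) := f.2
    rw [← tail_tail 1 k, h, ih, tail_tail]

theorem OneSidedAut.map_apply [TopologicalSpace A] (f : OneSidedAut A) (k : ℕ) (x : ℕ → A) :
    f.1 x k = f.1 (tail k x) 0 := by
  rw [OneSidedAut.map_tail f]
  simp

/-- Automorphisms of the one-sided shift preserve sequences that are constant from `k` on. -/
theorem OneSidedAut.const_from [TopologicalSpace A] (f : OneSidedAut A) {k : ℕ} {x : ℕ → A}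
    (h : ∀ n, k ≤ n → x (n + 1) = x n) (n : ℕ) (hn : k ≤ n) : f.1 x (n + 1) = f.1 x n := by
  have e : tail (n + 1) x = tail n x := by
    funext i
    have := h (n + i) (by omega)
    rw [tail_apply, tail_apply, ← this]
    congr 1
    omega
  rw [OneSidedAut.map_apply f, OneSidedAut.map_apply f n, e]

end Tail

/-! ### Automorphisms acting on strands -/

/-- A way of reading sequences over `A` inside configurations over `B`: the cells are the positions
with nonzero label, and a cell is continued `jump` positions further if the label there is the
same.  Labels do not change when the contents of cells change. -/
structure Strands (A B : Type*) [TopologicalSpace B] where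
  /-- Writing a symbol into a cell. -/
  enc : A → B
  /-- Reading the symbol of a cell. -/
  dec : B → A
  /-- The label of position `0`. -/
  label : (ℕ → B) → ℕ
  /-- The distance between consecutive cells. -/
  jump : ℕ
  dec_enc : ∀ a, dec (enc a) = a
  enc_dec : ∀ x, label x ≠ 0 → enc (dec (x 0)) = x 0
  continuous_label : Continuous label
  label_congr : ∀ x y, (∀ i, y i = x i ∨ label (tail i x) ≠ 0 ∧ ∃ a, y i = enc a) →
    label y = label x

namespace Strands

section Basic

variable {A B : Type*} [TopologicalSpace B] (S : Strands A B)

/-- The first `n` symbols read along the links, the last one being repeated when they end. -/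
def readAux : ℕ → (ℕ → B) → A
  | 0, x => S.dec (x 0)
  | n + 1, x => if S.label (tail S.jump x) = S.label x then readAux n (tail S.jump x)
      else S.dec (x 0)

/-- The sequence read along the links from position `0`. -/
def read (x : ℕ → B) : ℕ → A := fun n => S.readAux n x

theorem read_zero (x : ℕ → B) : S.read x 0 = S.dec (x 0) := rfl

theorem read_succ_of_link {x : ℕ → B} (h : S.label (tail S.jump x) = S.label x) (n : ℕ) :
    S.read x (n + 1) = S.read (tail S.jump x) n := by
  simp [read, readAux, h]

theorem read_succ_of_not_link {x : ℕ → B} (h : S.label (tail S.jump x) ≠ S.label x) (n : ℕ) :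
    S.read x (n + 1) = S.dec (x 0) := by
  simp [read, readAux, h]

/-- Reading a chain of `k + 1` cells with the contents of a sequence that is constant from `k` on. -/
theorem read_eq_of_chain {k : ℕ} {x : ℕ → B} {γ : ℕ → A}
    (hlink : ∀ j < k, S.label (tail ((j + 1) * S.jump) x) = S.label (tail (j * S.jump) x))
    (hend : S.label (tail ((k + 1) * S.jump) x) ≠ S.label (tail (k * S.jump) x))
    (hx : ∀ j ≤ k, x (j * S.jump) = S.enc (γ j)) (hγ : ∀ n, k ≤ n → γ (n + 1) = γ n) :
    S.read x = γ := by
  induction k generalizing x γ with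
  | zero =>
    funext n
    have h0 : S.dec (x 0) = γ 0 := by
      have := hx 0 le_rfl
      rw [Nat.zero_mul] at this
      rw [this, S.dec_enc]
    have hc : ∀ n, γ n = γ 0 := by
      intro n
      induction n with
      | zero => rfl
      | succ n ih => rw [hγ n (Nat.zero_le n), ih]
    cases n with
    | zero => exact h0
    | succ n =>
      rw [S.read_succ_of_not_link (by simpa using hend), h0, hc (n + 1)]
  | succ k ih =>
    funext n
    cases n with
    | zero =>
      have := hx 0 (Nat.zero_le _)
      rw [Nat.zero_mul] at this
      rw [read_zero, this, S.dec_enc]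
    | succ n =>
      have h0 := hlink 0 (Nat.succ_pos _)
      rw [S.read_succ_of_link (by simpa using h0)]
      have key : ∀ j, S.jump + j * S.jump = (j + 1) * S.jump := fun j => by ring
      refine congrFun (ih (x := tail S.jump x) (γ := tail 1 γ) ?_ ?_ ?_ ?_) n |>.trans ?_
      · intro j hj
        simpa [key] using hlink (j + 1) (by omega)
      · simpa [key] using hend
      · intro j hj
        simpa [key, add_comm] using hx (j + 1) (by omega)
      · intro n hn
        have := hγ (n + 1) (by omega)
        simp only [tail_apply]
        rw [show 1 + (n + 1) = n + 1 + 1 by omega, this, add_comm]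
      · simp [add_comm]

/-- The map on configurations that applies `f` to all the strands. -/
noncomputable def hat (f : (ℕ → A) → (ℕ → A)) (x : ℕ → B) : ℕ → B := fun i =>
  if S.label (tail i x) ≠ 0 then S.enc (f (S.read (tail i x)) 0) else x i

theorem tail_hat (f : (ℕ → A) → (ℕ → A)) (k : ℕ) (x : ℕ → B) :
    tail k (S.hat f x) = S.hat f (tail k x) := by
  funext i
  simp [hat]

theorem hat_zero (f : (ℕ → A) → (ℕ → A)) (x : ℕ → B) :
    S.hat f x 0 = if S.label x ≠ 0 then S.enc (f (S.read x) 0) else x 0 := by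
  simp [hat]

theorem hat_apply_of_label_ne (f : (ℕ → A) → (ℕ → A)) {x : ℕ → B} {i : ℕ}
    (h : S.label (tail i x) ≠ 0) :
    S.hat f x i = S.enc (f (S.read (tail i x)) 0) := if_pos h

theorem hat_apply_of_label_eq (f : (ℕ → A) → (ℕ → A)) {x : ℕ → B} {i : ℕ}
    (h : S.label (tail i x) = 0) : S.hat f x i = x i := if_neg (not_not.2 h)

theorem label_hat (f : (ℕ → A) → (ℕ → A)) (x : ℕ → B) : S.label (S.hat f x) = S.label x := by
  refine S.label_congr x _ fun i => ?_
  by_cases h : S.label (tail i x) = 0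
  · exact Or.inl (S.hat_apply_of_label_eq f h)
  · exact Or.inr ⟨h, _, S.hat_apply_of_label_ne f h⟩

end Basic

variable {A B : Type*} [TopologicalSpace A] [TopologicalSpace B] (S : Strands A B)

theorem continuous_read [DiscreteTopology B] : Continuous S.read := by
  refine continuous_pi fun n => ?_
  change Continuous (S.readAux n)
  induction n with
  | zero => exact continuous_of_discreteTopology.comp (continuous_apply 0)
  | succ n ih =>
    have hl : IsClopen {x | S.label (tail S.jump x) = S.label x} := by
      have : Continuous fun x => (S.label (tail S.jump x), S.label x) :=
        (S.continuous_label.comp (continuous_tail _)).prodMk S.continuous_label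
      exact (isClopen_discrete {p : ℕ × ℕ | p.1 = p.2}).preimage this
    refine continuous_if ?_ ?_ ?_
    · intro x hx
      rw [hl.frontier_eq] at hx
      exact hx.elim
    · exact (ih.comp (continuous_tail _)).continuousOn
    · exact (continuous_of_discreteTopology.comp (continuous_apply 0)).continuousOn

theorem continuous_hat [DiscreteTopology A] [DiscreteTopology B] {f : (ℕ → A) → (ℕ → A)} (hf : Continuous f) : Continuous (S.hat f) := by
  refine continuous_pi fun i => ?_
  have hl : IsClopen {x | S.label (tail i x) ≠ 0} :=
    (isClopen_discrete {p : ℕ | p ≠ 0}).preimage (S.continuous_label.comp (continuous_tail i))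
  refine continuous_if ?_ ?_ ?_
  · intro x hx
    rw [hl.frontier_eq] at hx
    exact hx.elim
  · exact (continuous_of_discreteTopology.comp ((continuous_apply 0).comp
      (hf.comp (S.continuous_read.comp (continuous_tail i))))).continuousOn
  · exact (continuous_apply i).continuousOn

/-- Labels, hence links, survive `hat`. Along a link the claim follows since `f` commutes with the
shift; at the end of a strand both sides are constant. This makes `hat` multiplicative. -/
theorem read_hat (f : OneSidedAut A) {x : ℕ → B} (hx : S.label x ≠ 0) :
    S.read (S.hat f.1 x) = f.1 (S.read x) := by
  have h0 : ∀ x, S.label x ≠ 0 → S.dec (S.hat f.1 x 0) = f.1 (S.read x) 0 := by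
    intro x hx
    rw [hat_zero, if_pos hx, S.dec_enc]
  funext n
  induction n generalizing x with
  | zero => exact h0 x hx
  | succ n ih =>
    by_cases hl : S.label (tail S.jump x) = S.label x
    · rw [S.read_succ_of_link (by rw [tail_hat, label_hat, label_hat, hl]), tail_hat,
        ih (by rwa [hl])]
      rw [show S.read (tail S.jump x) = tail 1 (S.read x) from ?_, OneSidedAut.map_tail f, tail_apply, add_comm]
      funext n
      rw [tail_apply, add_comm, S.read_succ_of_link hl]
    · rw [S.read_succ_of_not_link (by rwa [tail_hat, label_hat, label_hat]), h0 x hx]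
      -- The strand has a single cell, so it reads as a constant sequence, and `f` keeps it
      -- constant.
      have hc : ∀ n, 0 ≤ n → S.read x (n + 1) = S.read x n := by
        intro n _
        rw [S.read_succ_of_not_link hl]
        cases n with
        | zero => rfl
        | succ n => rw [S.read_succ_of_not_link hl]
      have hc' := OneSidedAut.const_from f hc
      clear ih
      induction n with
      | zero => exact (hc' 0 le_rfl).symm
      | succ n ih => rw [hc' (n + 1) (Nat.zero_le _), ih]

theorem hat_mul (f g : OneSidedAut A) (x : ℕ → B) :
    S.hat (f * g).1 x = S.hat f.1 (S.hat g.1 x) := by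
  funext i
  by_cases h : S.label (tail i x) = 0
  · rw [S.hat_apply_of_label_eq _ h, S.hat_apply_of_label_eq, S.hat_apply_of_label_eq _ h]
    rwa [tail_hat, label_hat]
  · rw [S.hat_apply_of_label_ne _ h, S.hat_apply_of_label_ne, tail_hat, S.read_hat g h]
    · rfl
    · rwa [tail_hat, label_hat]

theorem hat_one (x : ℕ → B) : S.hat (1 : OneSidedAut A).1 x = x := by
  funext i
  by_cases h : S.label (tail i x) = 0
  · rw [S.hat_apply_of_label_eq _ h]
  · rw [S.hat_apply_of_label_ne _ h]
    exact S.enc_dec _ h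

/-- The homomorphism letting automorphisms of the shift over `A` act on the strands in
configurations over `B`. -/
noncomputable def hom [DiscreteTopology A] [DiscreteTopology B] : OneSidedAut A →* OneSidedAut B where
  toFun f :=
    ⟨{ toFun := S.hat f.1
       invFun := S.hat (f⁻¹).1
       left_inv := fun x => by rw [← hat_mul, inv_mul_cancel, hat_one]
       right_inv := fun x => by rw [← hat_mul, mul_inv_cancel, hat_one]
       continuous_toFun := S.continuous_hat f.1.continuous
       continuous_invFun := S.continuous_hat (f⁻¹).1.continuous },
      fun x => (S.tail_hat f.1 1 x).symm⟩
  map_one' := by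
    ext x : 2
    exact S.hat_one x
  map_mul' f g := by
    ext x : 2
    exact S.hat_mul f g x

end Strands

/-! ### Monotonicity of the classes in the alphabet size -/

theorem InOneSidedClass.iff_exists_injective {n : ℕ} {G : Type*} [Group G] :
    InOneSidedClass n G ↔ ∃ φ : G →* OneSidedAut (Fin n), Function.Injective φ := by
  constructor
  · rintro ⟨H, ⟨e⟩⟩
    exact ⟨H.subtype.comp e.toMonoidHom, H.subtype_injective.comp e.injective⟩
  · rintro ⟨φ, hφ⟩
    exact ⟨φ.range, ⟨MonoidHom.ofInjective hφ⟩⟩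

/-- The strands that are the runs of symbols less than `n`. -/
def runStrands {n N : ℕ} [NeZero n] (h : n ≤ N) : Strands (Fin n) (Fin N) where
  enc := Fin.castLE h
  dec b := if hb : b.1 < n then ⟨b.1, hb⟩ else 0
  label x := if (x 0).1 < n then 1 else 0
  jump := 1
  dec_enc a := by simp
  enc_dec x hx := by
    have : (x 0).1 < n := by
      by_contra hc
      simp [hc] at hx
    ext
    simp [this]
  continuous_label :=
    (continuous_of_discreteTopology (f := fun b : Fin N => if b.1 < n then 1 else 0)).comp
      (continuous_apply 0)
  label_congr x y hxy := by
    rcases hxy 0 with h0 | ⟨h1, a, ha⟩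
    · rw [h0]
    · have : (x 0).1 < n := by
        by_contra hc
        simp [hc] at h1
      simp [ha, this]

/-- A configuration using only symbols below `n` is one infinite run, on which the image of `f` acts
as `f` itself. -/
theorem runStrands_hom_injective {n N : ℕ} [NeZero n] (h : n ≤ N) :
    Function.Injective (runStrands h).hom := by
  rw [injective_iff_map_eq_one]
  intro f hf
  have hread : ∀ x : ℕ → Fin n, (runStrands h).read (fun i => Fin.castLE h (x i)) = x := by
    intro x
    funext k
    induction k generalizing x with
    | zero => exact (runStrands h).dec_enc (x 0)
    | succ k ih =>
      rw [Strands.read_succ_of_link _ (by simp [runStrands])]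
      exact (ih (tail 1 x)).trans (by simp [add_comm])
  have h0 : ∀ x : ℕ → Fin n, f.1 x 0 = x 0 := by
    intro x
    have := congrArg (fun F : OneSidedAut (Fin N) => F.1 (fun i => Fin.castLE h (x i)) 0) hf
    change (runStrands h).hat f.1 _ 0 = Fin.castLE h (x 0) at this
    rw [Strands.hat_zero, if_pos (by simp [runStrands]), hread] at this
    exact Fin.castLE_injective h this
  ext x : 2
  funext k
  change f.1 x k = x k
  rw [OneSidedAut.map_apply f, h0, tail_apply, add_zero]

theorem subsingleton_oneSidedAut {A : Type*} [TopologicalSpace A] [Subsingleton A] :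
    Subsingleton (OneSidedAut A) :=
  ⟨fun f g => by
    ext x : 2
    exact Subsingleton.elim _ _⟩

theorem InOneSidedClass.mono {n N : ℕ} (h : n ≤ N) {G : Type*} [Group G]
    (hG : InOneSidedClass n G) : InOneSidedClass N G := by
  rw [InOneSidedClass.iff_exists_injective] at hG ⊢
  obtain ⟨φ, hφ⟩ := hG
  rcases Nat.eq_zero_or_pos n with rfl | hn
  · have := subsingleton_oneSidedAut (A := Fin 0)
    have := hφ.subsingleton
    exact ⟨1, Function.injective_of_subsingleton _⟩
  · have : NeZero n := ⟨hn.ne'⟩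
    exact ⟨(runStrands h).hom.comp φ, (runStrands_hom_injective h).comp hφ⟩

theorem continuous_of_prefix {B C : Type*} [TopologicalSpace B] [DiscreteTopology B]
    [TopologicalSpace C] {f : (ℕ → B) → C} (K : ℕ)
    (h : ∀ x y, (∀ i < K, y i = x i) → f y = f x) : Continuous f := by
  refine IsLocallyConstant.continuous ((IsLocallyConstant.iff_exists_open f).2 fun x =>
    ⟨⋂ i ∈ Finset.range K, (fun y : ℕ → B => y i) ⁻¹' {x i}, ?_, ?_, ?_⟩)
  · exact isOpen_biInter_finset fun i _ => (isOpen_discrete _).preimage (continuous_apply i)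
  · simp
  · intro y hy
    exact h x y fun i hi => by simpa using Set.mem_iInter₂.1 hy i (Finset.mem_range.2 hi)

/-! ### Blocks, locks and the commuting actions -/

section Blocks

variable {V : Type*} (Γ : SimpleGraph V) {m N : ℕ} (e : V ≃ Fin m)

/-- A symbol followed by the marker of the vertex `v`. -/
def SecondCell (v : V) (x : ℕ → Fin (N + 1)) : Prop :=
  x 0 ≠ Fin.last N ∧ x 1 = Fin.last N ∧ ∀ j : Fin m, x (2 + j) = Fin.last N ↔ j = e v

/-- Two symbols followed by the marker of the vertex `v`. -/
def FirstCell (v : V) (x : ℕ → Fin (N + 1)) : Prop :=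
  x 0 ≠ Fin.last N ∧ SecondCell e v (tail 1 x)

/-- `x` starts with two equal symbols followed by the marker of a vertex not adjacent to `v`. -/
def Locked (v : V) (x : ℕ → Fin (N + 1)) : Prop :=
  ∃ u, ¬ Γ.Adj u v ∧ FirstCell e u x ∧ x 0 = x 1

/-- The first block of `x` is neither followed by a block of type `v` nor by a lock. -/
def Frozen (v : V) (x : ℕ → Fin (N + 1)) : Prop :=
  ¬ FirstCell e v (tail (m + 3) x) ∧ ¬ Locked Γ e v (tail (m + 3) x)

variable {e}

theorem SecondCell.unique {u v : V} {x : ℕ → Fin (N + 1)} (hu : SecondCell e u x)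
    (hv : SecondCell e v x) : u = v :=
  e.injective ((hv.2.2 _).1 ((hu.2.2 _).2 rfl))

theorem FirstCell.unique {u v : V} {x : ℕ → Fin (N + 1)} (hu : FirstCell e u x)
    (hv : FirstCell e v x) : u = v :=
  hu.2.unique hv.2

theorem FirstCell.not_secondCell {u v : V} {x : ℕ → Fin (N + 1)} (hu : FirstCell e u x) :
    ¬ SecondCell e v x := fun hv => hu.2.1 hv.2.1

theorem SecondCell.congr {v : V} {x y : ℕ → Fin (N + 1)}
    (h : ∀ i < m + 2, y i = Fin.last N ↔ x i = Fin.last N) :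
    SecondCell e v y ↔ SecondCell e v x := by
  unfold SecondCell
  rw [Ne, Ne, h 0 (by omega), h 1 (by omega)]
  have : ∀ j : Fin m, y (2 + j) = Fin.last N ↔ x (2 + j) = Fin.last N :=
    fun j => h _ (by omega)
  simp only [this]

theorem FirstCell.congr {v : V} {x y : ℕ → Fin (N + 1)}
    (h : ∀ i < m + 3, y i = Fin.last N ↔ x i = Fin.last N) :
    FirstCell e v y ↔ FirstCell e v x := by
  unfold FirstCell
  have h1 : SecondCell e v (tail 1 y) ↔ SecondCell e v (tail 1 x) :=
    SecondCell.congr fun i hi => h (1 + i) (by omega)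
  rw [Ne, Ne, h 0 (by omega), h1]

variable (e)

open Classical in
/-- `1` for the first cells of blocks of type `v` that are not frozen, `2` for the second cells, and
`0` elsewhere. -/
noncomputable def blockLabel (v : V) (x : ℕ → Fin (N + 1)) : ℕ :=
  if FirstCell e v x ∧ ¬ Frozen Γ e v x then 1 else if SecondCell e v x then 2 else 0

variable {Γ e}

theorem blockLabel_eq_one_iff {v : V} {x : ℕ → Fin (N + 1)} :
    blockLabel Γ e v x = 1 ↔ FirstCell e v x ∧ ¬ Frozen Γ e v x := by
  unfold blockLabel
  split_ifs <;> simp_all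

theorem blockLabel_eq_two_iff {v : V} {x : ℕ → Fin (N + 1)} :
    blockLabel Γ e v x = 2 ↔ SecondCell e v x := by
  unfold blockLabel
  split_ifs with h h'
  · simpa using h.1.not_secondCell
  · simpa using h'
  · simpa using h'

theorem blockLabel_congr {v : V} {x y : ℕ → Fin (N + 1)}
    (h1 : FirstCell e v y ↔ FirstCell e v x) (h2 : SecondCell e v y ↔ SecondCell e v x)
    (h3 : Frozen Γ e v y ↔ Frozen Γ e v x) : blockLabel Γ e v y = blockLabel Γ e v x := by
  unfold blockLabel
  rw [h1, h2, h3]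

theorem cell_unique {u v : V} {x : ℕ → Fin (N + 1)} (hu : FirstCell e u x ∨ SecondCell e u x)
    (hv : FirstCell e v x ∨ SecondCell e v x) : u = v := by
  rcases hu with hu | hu <;> rcases hv with hv | hv
  · exact hu.unique hv
  · exact absurd hv hu.not_secondCell
  · exact absurd hu hv.not_secondCell
  · exact hu.unique hv

theorem cell_of_blockLabel_ne_zero {v : V} {x : ℕ → Fin (N + 1)} (h : blockLabel Γ e v x ≠ 0) :
    FirstCell e v x ∨ SecondCell e v x := by
  unfold blockLabel at h
  split_ifs at h with h1 h2
  · exact Or.inl h1.1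
  · exact Or.inr h2
  · exact absurd rfl h

variable (e) in
/-- `y` arises from `x` by changing the contents of some cells of type `v`. -/
def ChangedAt (v : V) (x y : ℕ → Fin (N + 1)) : Prop :=
  ∀ i, (y i = Fin.last N ↔ x i = Fin.last N) ∧
    (y i = x i ∨ FirstCell e v (tail i x) ∨ SecondCell e v (tail i x))

namespace ChangedAt

variable {v : V} {x y : ℕ → Fin (N + 1)}

theorem tail (h : ChangedAt e v x y) (k : ℕ) : ChangedAt e v (tail k x) (tail k y) := by
  intro i
  simpa using h (k + i)

theorem secondCell (h : ChangedAt e v x y) {w : V} : SecondCell e w y ↔ SecondCell e w x :=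
  SecondCell.congr fun i _ => (h i).1

theorem firstCell (h : ChangedAt e v x y) {w : V} : FirstCell e w y ↔ FirstCell e w x :=
  FirstCell.congr fun i _ => (h i).1

theorem zero_of_cell (h : ChangedAt e v x y) {w : V}
    (hw : FirstCell e w x ∨ SecondCell e w x) (hne : w ≠ v) : y 0 = x 0 := by
  refine (h 0).2.resolve_right fun h0 => hne (cell_unique hw ?_)
  simpa using h0

theorem zero_of_firstCell (h : ChangedAt e v x y) {w : V} (hw : FirstCell e w x) (hne : w ≠ v) :
    y 0 = x 0 := h.zero_of_cell (Or.inl hw) hne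

theorem one_of_firstCell (h : ChangedAt e v x y) {w : V} (hw : FirstCell e w x) (hne : w ≠ v) :
    y 1 = x 1 := (h.tail 1).zero_of_cell (Or.inr hw.2) hne

/-- Locks for `w` have types not adjacent to `w`, so never type `v`, and their contents are
untouched. -/
theorem locked (h : ChangedAt e v x y) {w : V} (hw : Γ.Adj v w) :
    Locked Γ e w y ↔ Locked Γ e w x := by
  unfold Locked
  refine exists_congr fun u => and_congr_right fun hu => ?_
  rw [h.firstCell]
  refine and_congr_right fun hx => ?_
  have hne : u ≠ v := by
    rintro rfl
    exact hu hw
  rw [h.zero_of_firstCell hx hne, h.one_of_firstCell hx hne]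

theorem locked_self (h : ChangedAt e v x y) (hx : ¬ FirstCell e v x) :
    Locked Γ e v y ↔ Locked Γ e v x := by
  unfold Locked
  refine exists_congr fun u => and_congr_right fun hu => ?_
  rw [h.firstCell]
  refine and_congr_right fun hx' => ?_
  have hne : u ≠ v := by
    rintro rfl
    exact hx hx'
  rw [h.zero_of_firstCell hx' hne, h.one_of_firstCell hx' hne]

/-- When `w = v`, the only lock that could change is a block of type `v`, but such a block already
prevents freezing whatever it contains. -/
theorem frozen (h : ChangedAt e v x y) {w : V} (hw : w = v ∨ Γ.Adj v w) :
    Frozen Γ e w y ↔ Frozen Γ e w x := by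
  unfold Frozen
  rw [(h.tail _).firstCell]
  refine and_congr_right fun hx => ?_
  rcases hw with rfl | hw
  · rw [(h.tail _).locked_self hx]
  · rw [(h.tail _).locked hw]

theorem blockLabel (h : ChangedAt e v x y) {w : V} (hw : w = v ∨ Γ.Adj v w) :
    blockLabel Γ e w y = blockLabel Γ e w x :=
   blockLabel_congr h.firstCell h.secondCell (h.frozen hw)

end ChangedAt

variable (Γ e)

/-- The strands of type `v`: the first cells of consecutive blocks, and the second ones. -/
noncomputable def blockStrands [NeZero N] (v : V) : Strands (Fin N) (Fin (N + 1)) where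
  enc := Fin.castSucc
  dec b := if h : b = Fin.last N then 0 else b.castPred h
  label := blockLabel Γ e v
  jump := m + 3
  dec_enc a := by simp [Fin.castSucc_ne_last]
  enc_dec x hx := by
    have : x 0 ≠ Fin.last N := (cell_of_blockLabel_ne_zero hx).elim (·.1) (·.1)
    simp [this]
  continuous_label := by
    -- A label depends only on a block and the block after it.
    refine continuous_of_prefix (2 * (m + 3)) fun x y h => ?_
    have h1 : ∀ w, SecondCell e w y ↔ SecondCell e w x := fun w =>
      SecondCell.congr fun i hi => by rw [h i (by omega)]
    have h2 : ∀ w, FirstCell e w y ↔ FirstCell e w x := fun w =>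
      FirstCell.congr fun i hi => by rw [h i (by omega)]
    have h3 : ∀ w, FirstCell e w (tail (m + 3) y) ↔ FirstCell e w (tail (m + 3) x) := fun w =>
      FirstCell.congr fun i hi => by rw [tail_apply, tail_apply, h _ (by omega)]
    refine blockLabel_congr (h2 v) (h1 v) ?_
    unfold Frozen Locked
    simp only [h3, tail_apply, h (m + 3 + 0) (by omega), h (m + 3 + 1) (by omega)]
  label_congr x y h := by
    refine ChangedAt.blockLabel (v := v) (fun i => ?_) (Or.inl rfl)
    rcases h i with h | ⟨h, a, ha⟩
    · simp [h]
    · have hc := cell_of_blockLabel_ne_zero h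
      have : x i ≠ Fin.last N := by simpa using hc.elim (·.1) (·.1)
      exact ⟨by simp [ha, this, Fin.castSucc_ne_last], Or.inr hc⟩

variable [NeZero N]

/-- The action of the automorphisms of the shift over `Fin N` on the strands of type `v`. -/
noncomputable def blockHom (v : V) : OneSidedAut (Fin N) →* OneSidedAut (Fin (N + 1)) :=
  (blockStrands Γ e v).hom

variable {Γ e}

theorem changedAt_blockHom (v : V) (f : OneSidedAut (Fin N)) (x : ℕ → Fin (N + 1)) :
    ChangedAt e v x ((blockHom Γ e v f).1 x) := by
  intro i
  change ((blockStrands Γ e v).hat f.1 x i = _ ↔ _) ∧ ((blockStrands Γ e v).hat f.1 x i = _ ∨ _)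
  by_cases h : blockLabel Γ e v (tail i x) = 0
  · rw [Strands.hat_apply_of_label_eq _ _ h]
    simp
  · rw [Strands.hat_apply_of_label_ne _ _ h]
    have hc := cell_of_blockLabel_ne_zero h
    have : x i ≠ Fin.last N := by simpa using hc.elim (·.1) (·.1)
    exact ⟨by simp [blockStrands, this, Fin.castSucc_ne_last], Or.inr hc⟩

theorem readAux_congr_of_changedAt {v w : V} (hw : Γ.Adj v w) (n : ℕ)
    {x y : ℕ → Fin (N + 1)} (h : ChangedAt e v x y) (hx : blockLabel Γ e w x ≠ 0) :
    (blockStrands Γ e w).readAux n y = (blockStrands Γ e w).readAux n x := by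
  have hl : ∀ {x y : ℕ → Fin (N + 1)}, ChangedAt e v x y →
      (blockStrands Γ e w).label y = (blockStrands Γ e w).label x :=
    fun h => h.blockLabel (Or.inr hw)
  have h0 : y 0 = x 0 := h.zero_of_cell (cell_of_blockLabel_ne_zero hx) hw.ne'
  induction n generalizing x y with
  | zero => simp only [Strands.readAux, h0]
  | succ n ih =>
    simp only [Strands.readAux, h0, hl h, hl (h.tail _)]
    split_ifs with hlink
    · have hx' : blockLabel Γ e w (tail (m + 3) x) ≠ 0 := fun hc => hx (hlink.symm.trans hc)
      exact ih (h.tail _) hx' ((h.tail _).zero_of_cell (cell_of_blockLabel_ne_zero hx') hw.ne')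
    · rfl

theorem blockHom_apply_of_label_eq {v : V} (f : OneSidedAut (Fin N)) {x : ℕ → Fin (N + 1)} {i : ℕ}
    (h : blockLabel Γ e v (tail i x) = 0) : (blockHom Γ e v f).1 x i = x i :=
  Strands.hat_apply_of_label_eq _ _ h

theorem blockHom_apply_of_label_ne {v : V} (f : OneSidedAut (Fin N)) {x : ℕ → Fin (N + 1)} {i : ℕ}
    (h : blockLabel Γ e v (tail i x) ≠ 0) : (blockHom Γ e v f).1 x i =
      Fin.castSucc (f.1 ((blockStrands Γ e v).read (tail i x)) 0) :=
  Strands.hat_apply_of_label_ne _ _ h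

/-- Cells of different types are disjoint, and for adjacent vertices neither action alters the
labels or the strand contents that the other one reads. -/
theorem blockHom_commute {v w : V} (hvw : Γ.Adj v w) (f g : OneSidedAut (Fin N)) :
    Commute (blockHom Γ e v f) (blockHom Γ e w g) := by
  have hl : ∀ {v w : V}, Γ.Adj v w → ∀ (f : OneSidedAut (Fin N)) (x : ℕ → Fin (N + 1)) (i : ℕ),
      blockLabel Γ e w (tail i ((blockHom Γ e v f).1 x)) = blockLabel Γ e w (tail i x) :=
    fun h f x i => ((changedAt_blockHom _ f x).tail i).blockLabel (Or.inr h)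
  have key : ∀ {v w : V}, Γ.Adj v w → ∀ (f g : OneSidedAut (Fin N)) (x : ℕ → Fin (N + 1)) (i : ℕ),
      blockLabel Γ e w (tail i x) ≠ 0 →
      (blockHom Γ e v f).1 ((blockHom Γ e w g).1 x) i =
        (blockHom Γ e w g).1 ((blockHom Γ e v f).1 x) i := by
    intro v w h f g x i hi
    have hv : blockLabel Γ e v (tail i x) = 0 := by
      by_contra hc
      exact h.ne (cell_unique (cell_of_blockLabel_ne_zero hc) (cell_of_blockLabel_ne_zero hi))
    rw [blockHom_apply_of_label_eq f ((hl h.symm g x i).trans hv), blockHom_apply_of_label_ne g hi,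
      blockHom_apply_of_label_ne g (by rwa [hl h])]
    have hr : (blockStrands Γ e w).read (tail i ((blockHom Γ e v f).1 x)) =
        (blockStrands Γ e w).read (tail i x) := by
      funext n
      exact readAux_congr_of_changedAt h n ((changedAt_blockHom v f x).tail i) hi
    rw [hr]
  ext x : 2
  funext i
  change (blockHom Γ e v f).1 ((blockHom Γ e w g).1 x) i =
    (blockHom Γ e w g).1 ((blockHom Γ e v f).1 x) i
  by_cases hw : blockLabel Γ e w (tail i x) = 0
  · by_cases hv : blockLabel Γ e v (tail i x) = 0
    · rw [blockHom_apply_of_label_eq f (by rwa [hl hvw.symm]), blockHom_apply_of_label_eq g hw,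
        blockHom_apply_of_label_eq g (by rwa [hl hvw]), blockHom_apply_of_label_eq f hv]
    · exact (key hvw.symm g f x i hv).symm
  · exact key hvw f g x i hw

end Blocks

/-! ### Detecting a nontrivial automorphism -/

/-- A nontrivial automorphism is detected at position `0` by a sequence `γ` made constant from some
position `k` on, and not by `γ` made constant from `k - 1` on. -/
theorem OneSidedAut.exists_detecting {A : Type*} [TopologicalSpace A] [DiscreteTopology A]
    {f : OneSidedAut A} (hf : f ≠ 1) : ∃ (γ : ℕ → A) (k : ℕ),
      f.1 (fun n => γ (min n k)) 0 ≠ γ 0 ∧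
        (k ≠ 0 → f.1 (fun n => γ (min n (k - 1))) 0 = γ 0) := by
  classical
  have h1 : ∃ γ : ℕ → A, f.1 γ 0 ≠ γ 0 := by
    by_contra! h
    refine hf ?_
    ext x : 2
    funext k
    change f.1 x k = x k
    rw [OneSidedAut.map_apply f, h, tail_apply, add_zero]
  obtain ⟨γ, hγ⟩ := h1
  have h2 : ∃ k, f.1 (fun n => γ (min n k)) 0 ≠ γ 0 := by
    by_contra! h
    refine hγ ?_
    -- The truncations converge to `γ`, so by continuity some truncation already detects `f`; the
    -- least such `k` is taken below.
    have hlim : Filter.Tendsto (fun k n => γ (min n k)) Filter.atTop (nhds γ) := by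
      refine tendsto_pi_nhds.2 fun n => tendsto_const_nhds.congr' ?_
      filter_upwards [Filter.eventually_ge_atTop n] with k hk
      rw [min_eq_left hk]
    have hl2 := ((continuous_apply 0).comp f.1.continuous).continuousAt.tendsto.comp hlim
    refine tendsto_nhds_unique hl2 (tendsto_const_nhds.congr fun k => ?_)
    exact (h k).symm
  refine ⟨γ, Nat.find h2, Nat.find_spec h2, fun h0 => ?_⟩
  by_contra hc
  exact Nat.find_min h2 (m := Nat.find h2 - 1) (by omega) hc

/-! ### Segments: runs with equal strands -/

section Segments

variable {V : Type*} {Γ : SimpleGraph V} {m N : ℕ} {e : V ≃ Fin m}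

variable (e) in
/-- `x` starts with exactly `k + 1` blocks of type `v`, both strands of which contain `γ`. -/
structure IsSegment (v : V) (k : ℕ) (x : ℕ → Fin (N + 1)) (γ : ℕ → Fin N) : Prop where
  firstCell : ∀ j ≤ k, FirstCell e v (tail (j * (m + 3)) x)
  first : ∀ j ≤ k, x (j * (m + 3)) = Fin.castSucc (γ j)
  second : ∀ j ≤ k, x (j * (m + 3) + 1) = Fin.castSucc (γ j)
  const : ∀ n, k ≤ n → γ (n + 1) = γ n
  not_firstCell : ¬ FirstCell e v (tail ((k + 1) * (m + 3)) x)
  not_secondCell : ¬ SecondCell e v (tail 1 (tail ((k + 1) * (m + 3)) x))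

theorem exists_block (v : V) (a : Fin N) (y : ℕ → Fin (N + 1)) :
    ∃ x, tail (m + 3) x = y ∧ FirstCell e v x ∧ x 0 = Fin.castSucc a ∧ x 1 = Fin.castSucc a := by
  refine ⟨fun i => if i < m + 3 then
    if i ≤ 1 then Fin.castSucc a else if i = 2 ∨ i = 3 + e v then Fin.last N else Fin.castSucc a
      else y (i - (m + 3)), ?_, ⟨?_, ?_, ?_, ?_⟩, ?_, ?_⟩
  · funext i
    simp
  · simp [Fin.castSucc_ne_last]
  · simp [Fin.castSucc_ne_last]
  · simp
  · intro j
    have h1 : 1 + (2 + (j : ℕ)) < m + 3 := by omega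
    have h2 : ¬ 1 + (2 + (j : ℕ)) ≤ 1 := by omega
    have h3 : (1 + (2 + (j : ℕ)) = 2 ∨ 1 + (2 + (j : ℕ)) = 3 + e v) ↔ j = e v := by
      rw [Fin.ext_iff]
      omega
    simp only [tail_apply, h1, h2, h3, if_true, if_false]
    split_ifs with h
    · simp [h]
    · simp [h, Fin.castSucc_ne_last]
  · simp
  · simp

theorem exists_isSegment (v : V) (k : ℕ) {γ : ℕ → Fin N} (hγ : ∀ n, k ≤ n → γ (n + 1) = γ n)
    {y : ℕ → Fin (N + 1)} (h1 : ¬ FirstCell e v y) (h2 : ¬ SecondCell e v (tail 1 y)) :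
    ∃ x, tail ((k + 1) * (m + 3)) x = y ∧ IsSegment e v k x γ := by
  have key : ∀ (K : ℕ) (γ : ℕ → Fin N), ∃ x : ℕ → Fin (N + 1), tail (K * (m + 3)) x = y ∧
      ∀ j < K, FirstCell e v (tail (j * (m + 3)) x) ∧ x (j * (m + 3)) = Fin.castSucc (γ j) ∧
        x (j * (m + 3) + 1) = Fin.castSucc (γ j) := by
    intro K
    induction K with
    | zero => exact fun _ => ⟨y, by simp, by simp⟩
    | succ K ih =>
      intro γ
      obtain ⟨x', hx', hx''⟩ := ih (tail 1 γ)
      obtain ⟨x, rfl, hx, h0, h1⟩ := exists_block (e := e) v (γ 0) x'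
      have hk : ∀ j, m + 3 + j * (m + 3) = (j + 1) * (m + 3) := fun j => by ring
      refine ⟨x, ?_, fun j hj => ?_⟩
      · rw [← hx', tail_tail, hk]
      · cases j with
        | zero => simpa using ⟨hx, h0, h1⟩
        | succ j =>
          have := hx'' j (by omega)
          rw [tail_tail, hk, tail_apply, tail_apply, tail_apply, ← add_assoc, hk,
            add_comm 1 j] at this
          exact this
  obtain ⟨x, hx, hx'⟩ := key (k + 1) γ
  exact ⟨x, hx, fun j hj => (hx' j (by omega)).1, fun j hj => (hx' j (by omega)).2.1,
    fun j hj => (hx' j (by omega)).2.2, hγ, by rwa [hx], by rwa [hx]⟩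

namespace IsSegment

variable {v : V} {k : ℕ} {x : ℕ → Fin (N + 1)} {γ : ℕ → Fin N}

theorem tail (h : IsSegment e v k x γ) {j : ℕ} (hj : j ≤ k) :
    IsSegment e v (k - j) (tail (j * (m + 3)) x) (tail j γ) := by
  have hk : ∀ i, j * (m + 3) + i * (m + 3) = (j + i) * (m + 3) := fun j => by ring
  have hkj : j + (k - j + 1) = k + 1 := by omega
  refine ⟨fun i hi => ?_, fun i hi => ?_, fun i hi => ?_, fun n hn => ?_, ?_, ?_⟩
  · rw [tail_tail, hk]
    exact h.firstCell _ (by omega)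
  · rw [tail_apply, hk]
    exact h.first _ (by omega)
  · rw [tail_apply, ← add_assoc, hk]
    exact h.second _ (by omega)
  · exact h.const (j + n) (by omega)
  · rw [tail_tail, hk, hkj]
    exact h.not_firstCell
  · rw [tail_tail _ (j * (m + 3)), hk, hkj]
    exact h.not_secondCell

theorem firstCell_zero (h : IsSegment e v k x γ) : FirstCell e v x := by
  simpa using h.firstCell 0 (Nat.zero_le _)

theorem label_second (h : IsSegment e v k x γ) {j : ℕ} (hj : j ≤ k) :
    blockLabel Γ e v (_root_.tail (j * (m + 3)) (_root_.tail 1 x)) = 2 := by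
  rw [blockLabel_eq_two_iff, tail_comm]
  exact (h.firstCell j hj).2

theorem label_first_of_lt (h : IsSegment e v k x γ) {j : ℕ} (hj : j < k) :
    blockLabel Γ e v (_root_.tail (j * (m + 3)) x) = 1 := by
  rw [blockLabel_eq_one_iff]
  refine ⟨h.firstCell j hj.le, fun hc => hc.1 ?_⟩
  rw [tail_tail, show j * (m + 3) + (m + 3) = (j + 1) * (m + 3) by ring]
  exact h.firstCell _ hj

/-- No block of type `v` follows the segment, so only a lock can unfreeze its last first cell. -/
theorem label_first_last (h : IsSegment e v k x γ) :
    blockLabel Γ e v (_root_.tail (k * (m + 3)) x) = 1 ↔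
      Locked Γ e v (_root_.tail ((k + 1) * (m + 3)) x) := by
  have hk : k * (m + 3) + (m + 3) = (k + 1) * (m + 3) := by ring
  rw [blockLabel_eq_one_iff, Frozen, tail_tail, hk]
  simp [h.firstCell k le_rfl, h.not_firstCell]

theorem label_first_of_locked (h : IsSegment e v k x γ)
    (hl : Locked Γ e v (_root_.tail ((k + 1) * (m + 3)) x)) {j : ℕ} (hj : j ≤ k) :
    blockLabel Γ e v (_root_.tail (j * (m + 3)) x) = 1 := by
  rcases hj.eq_or_lt with rfl | hj
  · exact h.label_first_last.2 hl
  · exact h.label_first_of_lt hj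

variable [NeZero N]

theorem read_second (h : IsSegment e v k x γ) :
    (blockStrands Γ e v).read (_root_.tail 1 x) = γ := by
  refine Strands.read_eq_of_chain _ (k := k) (fun j hj => ?_) ?_ (fun j hj => ?_) h.const
  · exact (h.label_second hj).trans (h.label_second hj.le).symm
  -- A second cell could occur after the segment without a first cell before it, so `not_firstCell`
  -- would not suffice to end this strand.
  · refine fun hc => h.not_secondCell ?_
    rw [tail_comm]
    exact blockLabel_eq_two_iff.1 (hc.trans (h.label_second le_rfl))
  · exact (congrArg x (add_comm _ _)).trans (h.second j hj)

theorem read_first_of_locked (h : IsSegment e v k x γ)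
    (hl : Locked Γ e v (_root_.tail ((k + 1) * (m + 3)) x)) :
    (blockStrands Γ e v).read x = γ := by
  refine Strands.read_eq_of_chain _ (k := k) (fun j hj => ?_) ?_ h.first h.const
  · exact (h.label_first_of_locked hl hj).trans (h.label_first_of_locked hl hj.le).symm
  · exact fun hc => h.not_firstCell
      (blockLabel_eq_one_iff.1 (hc.trans (h.label_first_of_locked hl le_rfl))).1

theorem read_first_of_not_locked (h : IsSegment e v (k + 1) x γ)
    (hl : ¬ Locked Γ e v (_root_.tail ((k + 2) * (m + 3)) x)) :
    (blockStrands Γ e v).read x = fun n => γ (min n k) := by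
  refine Strands.read_eq_of_chain _ (k := k) (fun j hj => ?_) ?_ (fun j hj => ?_) (fun n hn => ?_)
  · exact (h.label_first_of_lt (by omega)).trans (h.label_first_of_lt (by omega)).symm
  · exact fun hc => hl (h.label_first_last.1 (hc.trans (h.label_first_of_lt (by omega))))
  · rw [min_eq_left hj]
    exact h.first j (by omega)
  · rw [min_eq_right (by omega), min_eq_right hn]

theorem blockHom_one (h : IsSegment e v k x γ) (f : OneSidedAut (Fin N)) :
    (blockHom Γ e v f).1 x 1 = Fin.castSucc (f.1 γ 0) := by
  have hl := h.label_second (Γ := Γ) (Nat.zero_le k)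
  rw [Nat.zero_mul, tail_zero] at hl
  rw [blockHom_apply_of_label_ne f (by rw [hl]; decide), h.read_second]

theorem blockHom_zero_of_locked (h : IsSegment e v k x γ) (f : OneSidedAut (Fin N))
    (hl : Locked Γ e v (_root_.tail ((k + 1) * (m + 3)) x)) :
    (blockHom Γ e v f).1 x 0 = Fin.castSucc (f.1 γ 0) := by
  have hl' := h.label_first_of_locked hl (Nat.zero_le k)
  rw [Nat.zero_mul] at hl'
  rw [blockHom_apply_of_label_ne f (by rw [hl']; decide), tail_zero, h.read_first_of_locked hl]

/-- If the segment is not followed by a lock, an automorphism detected by its contents makes the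
first two symbols different. -/
theorem blockHom_ne_of_not_locked {f : OneSidedAut (Fin N)}
    (h : IsSegment e v k x fun n => γ (min n k))
    (hl : ¬ Locked Γ e v (_root_.tail ((k + 1) * (m + 3)) x))
    (hk : f.1 (fun n => γ (min n k)) 0 ≠ γ 0)
    (hk' : k ≠ 0 → f.1 (fun n => γ (min n (k - 1))) 0 = γ 0) :
    (blockHom Γ e v f).1 x 0 ≠ (blockHom Γ e v f).1 x 1 := by
  rw [h.blockHom_one]
  have h0 : (blockHom Γ e v f).1 x 0 = Fin.castSucc (γ 0) := by
    cases k with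
    | zero =>
      -- In a segment of one block, the first cell is itself the frozen one and keeps its symbol.
      have h1 : blockLabel Γ e v (_root_.tail 0 x) = 0 := by
        have hx := h.firstCell_zero
        have h1 := mt h.label_first_last.1 hl
        rw [Nat.zero_mul, tail_zero] at h1
        have h2 := mt (blockLabel_eq_two_iff (Γ := Γ)).1 (hx.not_secondCell (v := v))
        rw [tail_zero]
        unfold blockLabel at h1 h2 ⊢
        split_ifs at h1 h2 ⊢ <;> simp_all
      rw [blockHom_apply_of_label_eq f h1]
      simpa using h.first 0 le_rfl
    | succ k =>
      have h1 := h.label_first_of_lt (Γ := Γ) (Nat.succ_pos k)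
      rw [Nat.zero_mul] at h1
      rw [blockHom_apply_of_label_ne f (by rw [h1]; decide), tail_zero,
        h.read_first_of_not_locked hl, ← hk' (Nat.succ_ne_zero k)]
      have hm : (fun n => γ (min (min n k) (k + 1))) = fun n => γ (min n (k + 1 - 1)) := by
        funext n
        congr 1
        omega
      rw [hm]
  rw [h0]
  exact fun hc => hk (Fin.castSucc_injective _ hc).symm

/-- With the lock closed both strands have full length and read the same sequence, so they stay
equal. -/
theorem map_of_locked (h : IsSegment e v k x γ) (f : OneSidedAut (Fin N))
    (hl : Locked Γ e v (_root_.tail ((k + 1) * (m + 3)) x)) :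
    IsSegment e v k ((blockHom Γ e v f).1 x) (f.1 γ) := by
  have hc := changedAt_blockHom (Γ := Γ) (e := e) v f x
  have hl' : ∀ j ≤ k, Locked Γ e v
      (_root_.tail ((k - j + 1) * (m + 3)) (_root_.tail (j * (m + 3)) x)) := by
    intro j hj
    rwa [tail_tail, ← add_mul, show j + (k - j + 1) = k + 1 by omega]
  refine ⟨fun j hj => ?_, fun j hj => ?_, fun j hj => ?_, OneSidedAut.const_from f h.const, ?_, ?_⟩
  · exact (hc.tail _).firstCell.2 (h.firstCell j hj)
  · rw [OneSidedAut.map_apply, (h.tail hj).blockHom_zero_of_locked f (hl' j hj),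
      ← OneSidedAut.map_apply]
  · change _root_.tail (j * (m + 3)) ((blockHom Γ e v f).1 x) 1 = _
    rw [← OneSidedAut.map_tail, (h.tail hj).blockHom_one f, ← OneSidedAut.map_apply]
  · exact mt (hc.tail _).firstCell.1 h.not_firstCell
  · exact mt ((hc.tail _).tail _).secondCell.1 h.not_secondCell

theorem map_of_ne (h : IsSegment e v k x γ) {w : V} (hw : w ≠ v) (f : OneSidedAut (Fin N)) :
    IsSegment e v k ((blockHom Γ e w f).1 x) γ := by
  have hc := changedAt_blockHom (Γ := Γ) (e := e) w f x
  refine ⟨fun j hj => ?_, fun j hj => ?_, fun j hj => ?_, h.const, ?_, ?_⟩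
  · exact (hc.tail _).firstCell.2 (h.firstCell j hj)
  · rw [← h.first j hj]
    exact (hc.tail _).zero_of_firstCell (h.firstCell j hj) hw.symm
  · rw [← h.second j hj]
    exact (hc.tail _).one_of_firstCell (h.firstCell j hj) hw.symm
  · exact mt (hc.tail _).firstCell.1 h.not_firstCell
  · exact mt ((hc.tail _).tail _).secondCell.1 h.not_secondCell

end IsSegment

end Segments

/-! ### Reduced words act nontrivially -/

theorem List.exists_first {α : Type*} {p : α → Prop} {l : List α} (h : ∃ a ∈ l, p a) :
    ∃ as a bs, l = as ++ a :: bs ∧ p a ∧ ∀ c ∈ as, ¬ p c := by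
  classical
  induction l with
  | nil => simp at h
  | cons b l ih =>
    by_cases hb : p b
    · exact ⟨[], b, l, rfl, hb, by simp⟩
    · obtain ⟨as, a, bs, rfl, ha, has⟩ := ih (by simpa [hb] using h)
      exact ⟨b :: as, a, bs, rfl, ha, by simpa [hb] using has⟩

theorem List.cons_suffix_of_suffix_append {α : Type*} {d : α} {l as bs : List α}
    (h : d :: l <:+ as ++ bs) (hd : d ∉ as) : d :: l <:+ bs := by
  obtain ⟨t, ht⟩ := h
  rcases List.append_eq_append_iff.1 ht with ⟨as', rfl, h⟩ | ⟨bs', rfl, h⟩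
  · cases as' with
    | nil => exact ⟨[], h⟩
    | cons c as' =>
      obtain ⟨rfl, _⟩ := List.cons.inj h
      simp at hd
  · exact ⟨bs', h.symm⟩

section Words

variable {V : Type*} (Γ : SimpleGraph V) {G : V → Type*} [∀ v, Group (G v)]

/-- Words without trivial letters, in which two letters from the same vertex group are always
separated by a letter not commuting with them. -/
structure IsReducedWord (l : List (Σ v, G v)) : Prop where
  ne_one : ∀ a ∈ l, a.2 ≠ 1
  separated : ∀ as a bs b cs, l = as ++ a :: (bs ++ b :: cs) → a.1 = b.1 →
    (∀ c ∈ bs, c.1 ≠ a.1) → ∃ c ∈ bs, ¬ Γ.Adj a.1 c.1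

variable {Γ}

theorem IsReducedWord.of_append {l l' : List (Σ v, G v)} (h : IsReducedWord Γ (l ++ l')) :
    IsReducedWord Γ l' :=
  ⟨fun a ha => h.ne_one a (List.mem_append_right _ ha), fun as a bs b cs hl =>
    h.separated (l ++ as) a bs b cs (by rw [hl, List.append_assoc])⟩

variable (Γ) {m N : ℕ} (e : V ≃ Fin m) (ρ : ∀ v, G v →* OneSidedAut (Fin N))

open Classical in
/-- The product of the letters of a word that belong to the vertex `v`. -/
noncomputable def vertexProd (v : V) (l : List (Σ v, G v)) : OneSidedAut (Fin N) :=
  (l.map fun a => if a.1 = v then ρ a.1 a.2 else 1).prod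

variable {Γ e ρ}

theorem vertexProd_cons_of_eq {v : V} {a : Σ v, G v} (h : a.1 = v) (l : List (Σ v, G v)) :
    vertexProd ρ v (a :: l) = ρ a.1 a.2 * vertexProd ρ v l := by
  rw [vertexProd, List.map_cons, List.prod_cons, if_pos h]
  rfl

theorem vertexProd_cons_of_ne {v : V} {a : Σ v, G v} (h : a.1 ≠ v) (l : List (Σ v, G v)) :
    vertexProd ρ v (a :: l) = vertexProd ρ v l := by
  rw [vertexProd, List.map_cons, List.prod_cons, if_neg h, one_mul]
  rfl

variable [NeZero N]

variable (Γ e ρ) in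
/-- The action of a word, the last letter acting first. -/
noncomputable def wordHom (l : List (Σ v, G v)) : OneSidedAut (Fin (N + 1)) :=
  (l.map fun a => blockHom Γ e a.1 (ρ a.1 a.2)).prod

theorem wordHom_cons (a : Σ v, G v) (l : List (Σ v, G v)) (x : ℕ → Fin (N + 1)) :
    (wordHom Γ e ρ (a :: l)).1 x = (blockHom Γ e a.1 (ρ a.1 a.2)).1 ((wordHom Γ e ρ l).1 x) := by
  rw [wordHom, List.map_cons, List.prod_cons]
  rfl

theorem firstCell_wordHom (l : List (Σ v, G v)) (x : ℕ → Fin (N + 1)) {v : V} :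
    FirstCell e v ((wordHom Γ e ρ l).1 x) ↔ FirstCell e v x := by
  induction l with
  | nil => rfl
  | cons a l ih => rw [wordHom_cons, (changedAt_blockHom _ _ _).firstCell, ih]

theorem wordHom_append_eq_iff {l l' : List (Σ v, G v)} {x : ℕ → Fin (N + 1)} {v : V}
    (hx : FirstCell e v x) (hl : ∀ a ∈ l, a.1 ≠ v) :
    (wordHom Γ e ρ (l ++ l')).1 x 0 = (wordHom Γ e ρ (l ++ l')).1 x 1 ↔
      (wordHom Γ e ρ l').1 x 0 = (wordHom Γ e ρ l').1 x 1 := by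
  induction l with
  | nil => rfl
  | cons a l ih =>
    have hc := changedAt_blockHom (Γ := Γ) (e := e) a.1 (ρ a.1 a.2) ((wordHom Γ e ρ (l ++ l')).1 x)
    have hx' := (firstCell_wordHom (Γ := Γ) (ρ := ρ) (l ++ l') x).2 hx
    have ha : v ≠ a.1 := (hl a List.mem_cons_self).symm
    rw [List.cons_append, wordHom_cons, hc.zero_of_firstCell hx' ha, hc.one_of_firstCell hx' ha]
    exact ih fun b hb => hl b (List.mem_cons_of_mem _ hb)

/-- Only letters at `v` touch the segment, and each of them meets a closed lock. -/
theorem IsSegment.wordHom {v : V} {k : ℕ} {x : ℕ → Fin (N + 1)} {γ : ℕ → Fin N}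
    (h : IsSegment e v k x γ) (l : List (Σ v, G v))
    (hl : ∀ b l', b :: l' <:+ l → b.1 = v →
      Locked Γ e v ((wordHom Γ e ρ l').1 (_root_.tail ((k + 1) * (m + 3)) x))) :
    IsSegment e v k ((wordHom Γ e ρ l).1 x) ((vertexProd ρ v l).1 γ) := by
  induction l with
  | nil => exact h
  | cons a l ih =>
    have ih' := ih fun b l' hb => hl b l' (hb.trans (List.suffix_cons a l))
    rw [wordHom_cons]
    by_cases ha : a.1 = v
    · rw [vertexProd_cons_of_eq ha]
      have hlock := hl a l (List.suffix_refl _) ha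
      rw [OneSidedAut.map_tail] at hlock
      subst ha
      exact ih'.map_of_locked _ hlock
    · rw [vertexProd_cons_of_ne ha]
      exact ih'.map_of_ne ha _

/-- Given a configuration that locks segments of type `v` whenever a letter of `l` at `v` acts, but
not after `l`, put a segment in front of it that is unbalanced by a further letter at `v`. -/
theorem exists_unbalanced_of_locked {v : V} {g : G v} {l : List (Σ v, G v)} (hg : ρ v g ≠ 1)
    {y : ℕ → Fin (N + 1)} (h1 : ¬ FirstCell e v y) (h2 : ¬ SecondCell e v (tail 1 y))
    (hl : ∀ b l', b :: l' <:+ l → b.1 = v → Locked Γ e v ((wordHom Γ e ρ l').1 y))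
    (hy : ¬ Locked Γ e v ((wordHom Γ e ρ l).1 y)) :
    ∃ x, FirstCell e v x ∧
      (∀ l', l' <:+ l → (wordHom Γ e ρ l').1 x 0 = (wordHom Γ e ρ l').1 x 1) ∧
      (wordHom Γ e ρ (⟨v, g⟩ :: l)).1 x 0 ≠ (wordHom Γ e ρ (⟨v, g⟩ :: l)).1 x 1 := by
  obtain ⟨γ, k, hk, hk'⟩ := OneSidedAut.exists_detecting hg
  have hβ : ∀ n, k ≤ n → γ (min (n + 1) k) = γ (min n k) := fun n hn => by
    rw [min_eq_right hn, min_eq_right (by omega)]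
  -- The initial contents are pulled back along the letters of `l` at `v`, so that the detecting
  -- sequence stands in the segment when `g` acts.
  obtain ⟨x, rfl, hx⟩ := exists_isSegment v k
    (OneSidedAut.const_from (vertexProd ρ v l)⁻¹ (x := fun n => γ (min n k)) hβ) h1 h2
  refine ⟨x, hx.firstCell_zero, fun l' hl' => ?_, ?_⟩
  · have hs := hx.wordHom l' fun b l'' hb => hl b l'' (hb.trans hl')
    have ha := hs.first 0 (Nat.zero_le k)
    have hb := hs.second 0 (Nat.zero_le k)
    rw [Nat.zero_mul] at ha hb
    exact ha.trans hb.symm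
  · have hs := hx.wordHom l hl
    rw [wordHom_cons]
    have hγ : (vertexProd ρ v l).1 ((vertexProd ρ v l)⁻¹.1 fun n => γ (min n k)) =
        fun n => γ (min n k) := by
      change (vertexProd ρ v l * (vertexProd ρ v l)⁻¹).1 _ = _
      rw [mul_inv_cancel]
      rfl
    rw [hγ] at hs
    rw [OneSidedAut.map_tail] at hy
    exact hs.blockHom_ne_of_not_locked hy hk hk'

/-- For a nonempty reduced word, some configuration starts with a block that is unbalanced by the
word, but not by its proper suffixes. -/
theorem IsReducedWord.exists_unbalanced (hρ : ∀ v, Function.Injective (ρ v)) (n : ℕ)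
    {v : V} {g : G v} {l : List (Σ v, G v)} (hn : l.length = n)
    (h : IsReducedWord Γ (⟨v, g⟩ :: l)) :
    ∃ x, FirstCell e v x ∧
      (∀ l', l' <:+ l → (wordHom Γ e ρ l').1 x 0 = (wordHom Γ e ρ l').1 x 1) ∧
      (wordHom Γ e ρ (⟨v, g⟩ :: l)).1 x 0 ≠ (wordHom Γ e ρ (⟨v, g⟩ :: l)).1 x 1 := by
  induction n using Nat.strong_induction_on generalizing v g l with
  | _ n ih =>
  have hg : ρ v g ≠ 1 := fun hc =>
    h.ne_one ⟨v, g⟩ List.mem_cons_self ((injective_iff_map_eq_one _).1 (hρ v) g hc)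
  by_cases hv : ∃ b ∈ l, b.1 = v
  · obtain ⟨bs, b, cs, rfl, rfl, hbs⟩ := List.exists_first hv
    obtain ⟨c, hc, hadj⟩ := h.separated [] _ bs b cs rfl rfl hbs
    -- Taking the first letter at this vertex ensures that no letter of `as` can touch the lock
    -- after it has been opened.
    obtain ⟨as, ⟨u, a⟩, ds, rfl, hu, has⟩ :=
      List.exists_first (p := fun a : Σ v, G v => a.1 = c.1) ⟨c, hc, rfl⟩
    have huv : u ≠ b.1 := hbs ⟨u, a⟩ (by simp)
    have hadj' : ¬ Γ.Adj u b.1 := fun hc => hadj (by rw [← hu]; exact hc.symm)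
    have hred : IsReducedWord Γ (⟨u, a⟩ :: (ds ++ b :: cs)) :=
      IsReducedWord.of_append (l := ⟨b.1, g⟩ :: as) (by simpa using h)
    obtain ⟨y, hy, hy1, hy2⟩ := ih (ds ++ b :: cs).length
      (by rw [← hn]; simp only [List.length_append, List.length_cons]; omega) rfl hred
    have has' : ∀ x ∈ as, x.1 ≠ u := fun x hx hc => has x hx (hc.trans hu)
    refine exists_unbalanced_of_locked hg (y := y) (fun hc => huv (hy.unique hc))
      (fun hc => huv (hy.2.unique hc)) ?_ ?_
    · intro d l' hd hdv
      -- Every letter at `v` in `l` acts before the letter at `u`, while the lock is still closed.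
      have hsuf : d :: l' <:+ ds ++ b :: cs := by
        have h0 : (as ++ ⟨u, a⟩ :: ds) ++ b :: cs = (as ++ [⟨u, a⟩]) ++ (ds ++ b :: cs) := by simp
        rw [h0] at hd
        refine List.cons_suffix_of_suffix_append hd fun hmem => ?_
        rcases List.mem_append.1 hmem with hm | hm
        · exact hbs d (List.mem_append_left _ hm) hdv
        · rw [List.mem_singleton.1 hm] at hdv
          exact huv hdv
      exact ⟨u, hadj', (firstCell_wordHom l' y).2 hy,
        hy1 l' ((List.suffix_cons d l').trans hsuf)⟩
    · rintro ⟨w, _, hw, heq⟩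
      rw [List.append_assoc, List.cons_append, wordHom_append_eq_iff hy has'] at heq
      exact hy2 heq
  · push Not at hv
    -- No letter of `l` is at `v`, so no closed lock is ever needed; the all-marker tail contains no
    -- blocks and hence no locks.
    have hlast : ∀ w, ¬ FirstCell e w (fun _ : ℕ => Fin.last N) := fun w hw => hw.1 rfl
    refine exists_unbalanced_of_locked hg (y := fun _ => Fin.last N) (hlast v)
      (fun hc => hc.1 rfl) ?_ ?_
    · exact fun b l' hb hbv => absurd hbv (hv b (hb.subset List.mem_cons_self))
    · rintro ⟨w, _, hw, _⟩
      exact hlast w ((firstCell_wordHom l _).1 hw)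

theorem IsReducedWord.wordHom_ne_one (hρ : ∀ v, Function.Injective (ρ v))
    {l : List (Σ v, G v)} (h : IsReducedWord Γ l) (hl : l ≠ []) : wordHom Γ e ρ l ≠ 1 := by
  obtain ⟨⟨v, g⟩, l, rfl⟩ := List.exists_cons_of_ne_nil hl
  obtain ⟨x, _, hx1, hx2⟩ := h.exists_unbalanced (e := e) hρ _ rfl
  intro hc
  rw [hc] at hx2
  exact hx2 (hx1 [] (List.nil_suffix))

end Words

/-! ### Words and homomorphisms for graph products -/

namespace GraphProduct

variable {V : Type*} (Γ : SimpleGraph V) (G : V → Type*) [∀ v, Group (G v)]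

/-- The canonical map from a vertex group to the graph product. -/
def of (v : V) : G v →* GraphProduct Γ G :=
  (QuotientGroup.mk' (Subgroup.normalClosure (graphProductRelators Γ G))).comp Monoid.CoprodI.of

/-- The element of the graph product given by a word. -/
def wordProd (l : List (Σ v, G v)) : GraphProduct Γ G := (l.map fun a => of Γ G a.1 a.2).prod

variable {Γ G}

theorem of_commute {v w : V} (h : Γ.Adj v w) (a : G v) (b : G w) :
    Commute (of Γ G v a) (of Γ G w b) := by
  have : (QuotientGroup.mk' (Subgroup.normalClosure (graphProductRelators Γ G)))
      (Monoid.CoprodI.of a * Monoid.CoprodI.of b * (Monoid.CoprodI.of a)⁻¹ *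
      (Monoid.CoprodI.of b)⁻¹) = 1 :=
    (QuotientGroup.eq_one_iff _).2 (Subgroup.subset_normalClosure ⟨v, w, h, a, b, rfl⟩)
  rw [map_mul, map_mul, map_mul, map_inv, map_inv, mul_inv_eq_one, mul_inv_eq_iff_eq_mul] at this
  exact this

theorem exists_wordProd_eq (x : GraphProduct Γ G) : ∃ l, wordProd Γ G l = x := by
  obtain ⟨y, rfl⟩ := QuotientGroup.mk'_surjective _ x
  induction y using Monoid.CoprodI.induction_on with
  | one => exact ⟨[], (map_one _).symm⟩
  | of v a => exact ⟨[⟨v, a⟩], by simp only [wordProd, List.map_cons, List.map_nil, List.prod_singleton]; rfl⟩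
  | mul x y hx hy =>
    obtain ⟨l, hl⟩ := hx
    obtain ⟨l', hl'⟩ := hy
    refine ⟨l ++ l', ?_⟩
    rw [map_mul, ← hl, ← hl']
    simp only [wordProd, List.map_append, List.prod_append]
    rfl

/-- A shortest word is reduced: a trivial letter could be dropped, and two letters of one group
separated only by letters commuting with them could be merged. -/
theorem exists_reduced_wordProd_eq (x : GraphProduct Γ G) :
    ∃ l, wordProd Γ G l = x ∧ IsReducedWord Γ l := by
  classical
  have hex : ∃ n l, wordProd Γ G l = x ∧ l.length = n := by
    obtain ⟨l, hl⟩ := exists_wordProd_eq x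
    exact ⟨_, l, hl, rfl⟩
  obtain ⟨l, rfl, hl⟩ := Nat.find_spec hex
  have hmin : ∀ l', wordProd Γ G l' = wordProd Γ G l → l.length ≤ l'.length := fun l' h =>
    hl.trans_le (Nat.find_min' hex ⟨l', h, rfl⟩)
  clear hl
  refine ⟨l, rfl, ⟨fun a ha h1 => ?_, fun as a bs b cs hl hab hbs => ?_⟩⟩
  · obtain ⟨as, bs, rfl⟩ := List.append_of_mem ha
    have := hmin (as ++ bs) (by simp [wordProd, h1])
    simp at this
  · by_contra! hadj
    obtain ⟨v, a⟩ := a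
    obtain ⟨w, b⟩ := b
    obtain rfl : v = w := hab
    have hcomm : Commute (of Γ G v a) (wordProd Γ G bs) := by
      refine Commute.list_prod_right _ _ fun y hy => ?_
      obtain ⟨c, hc, rfl⟩ := List.mem_map.1 hy
      exact of_commute (hadj c hc) a c.2
    have := hmin (as ++ (bs ++ ⟨v, a * b⟩ :: cs)) ?_
    · rw [hl] at this
      simp at this
    · rw [hl]
      simp only [wordProd, List.map_append, List.map_cons, List.prod_append, List.prod_cons,
        map_mul]
      rw [wordProd] at hcomm
      simp only [← mul_assoc]
      rw [mul_assoc (as.map fun c => of Γ G c.1 c.2).prod (of Γ G v a), hcomm.eq]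
      simp only [mul_assoc]

/-- Homomorphisms from the vertex groups whose images commute along the edges factor through the
graph product. -/
def lift {H : Type*} [Group H] (φ : ∀ v, G v →* H)
    (h : ∀ v w, Γ.Adj v w → ∀ a b, Commute (φ v a) (φ w b)) : GraphProduct Γ G →* H :=
  QuotientGroup.lift _ (Monoid.CoprodI.lift φ) (by
    refine Subgroup.normalClosure_le_normal ?_
    rintro _ ⟨v, w, hvw, a, b, rfl⟩
    change Monoid.CoprodI.lift φ _ = 1
    rw [map_mul, map_mul, map_mul, map_inv, map_inv, Monoid.CoprodI.lift_of,
      Monoid.CoprodI.lift_of, (h v w hvw a b).eq]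
    group)

theorem lift_wordProd {H : Type*} [Group H] (φ : ∀ v, G v →* H)
    (h : ∀ v w, Γ.Adj v w → ∀ a b, Commute (φ v a) (φ w b)) (l : List (Σ v, G v)) :
    lift φ h (wordProd Γ G l) = (l.map fun a => φ a.1 a.2).prod := by
  rw [wordProd, map_list_prod, List.map_map]
  congr 2

theorem subsingleton [∀ v, Subsingleton (G v)] : Subsingleton (GraphProduct Γ G) := by
  refine subsingleton_of_forall_eq 1 fun x => ?_
  obtain ⟨l, rfl⟩ := exists_wordProd_eq x
  refine List.prod_eq_one fun y hy => ?_
  obtain ⟨a, _, rfl⟩ := List.mem_map.1 hy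
  rw [Subsingleton.elim a.2 1, map_one]

end GraphProduct

/-! ### The main theorem -/

theorem mainTheorem3 {V : Type*} [Fintype V] (Γ : SimpleGraph V)
    (G : V → Type*) [∀ i, Group (G i)] (n : V → ℕ)
    (hG : ∀ i, InOneSidedClass (n i) (G i)) :
    InOneSidedClass (Finset.univ.sup n + 1) (GraphProduct Γ G) := by
  have hle : ∀ i, n i ≤ Finset.univ.sup n := fun i => Finset.le_sup (Finset.mem_univ i)
  generalize Finset.univ.sup n = N at hle
  have hG' := fun i => InOneSidedClass.iff_exists_injective.1 ((hG i).mono (hle i))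
  choose ρ hρ using hG'
  rw [InOneSidedClass.iff_exists_injective]
  rcases Nat.eq_zero_or_pos N with rfl | hN
  -- With `N = 0` there is no ordinary symbol to fill blocks, but all vertex groups are trivial.
  · have := subsingleton_oneSidedAut (A := Fin 0)
    have := fun i => (hρ i).subsingleton
    have := GraphProduct.subsingleton (Γ := Γ) (G := G)
    exact ⟨1, Function.injective_of_subsingleton _⟩
  have : NeZero N := ⟨hN.ne'⟩
  let e := Fintype.equivFin V
  refine ⟨GraphProduct.lift (fun v => (blockHom Γ e v).comp (ρ v))
    fun v w hvw a b => blockHom_commute hvw _ _, (injective_iff_map_eq_one _).2 fun x hx => ?_⟩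
  obtain ⟨l, rfl, hl⟩ := GraphProduct.exists_reduced_wordProd_eq x
  rw [GraphProduct.lift_wordProd] at hx
  by_contra hne
  exact hl.wordHom_ne_one (e := e) hρ (fun h0 => hne (by rw [h0]; rfl)) hx
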